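/- Let $q$ be a complex number with $|q|<1$, and write $(a;q)_n=\prod_{i=0}^{n-1}(1-aq^i)$ for $n\ge 0$ and $(a;q)_\infty=\prod_{i=0}^{\infty}(1-aq^i)$. Then for every integer $k\ge 2$, $$\sum_{N_1\ge N_2\ge\cdots\ge N_{k-1}\ge 0}\frac{q^{N_1(N_1+1)/2+N_2^2+\cdots+N_{k-1}^2+N_2+\cdots+N_{k-1}}\,(-q;q)_{N_1}}{(q;q)_{N_1-N_2}\cdots(q;q)_{N_{k-2}-N_{k-1}}\,(q;q)_{N_{k-1}}}=\frac{(-q;q)_\infty\,(q;q^{2k})_\infty\,(q^{2k-1};q^{2k})_\infty\,(q^{2k};q^{2k})_\infty}{(q;q)_\infty},$$ where the sum runs over all $(k-1)$-tuples of integers $N_1\ge\cdots\ge N_{k-1}\ge 0$ and converges absolutely. (For $k=2$ the summand is $q^{N_1(N_1+1)/2}(-q;q)_{N_1}/(q;q)_{N_1}$.) -/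

import Mathlib

open scoped BigOperators

noncomputable section

/-- The finite `q`-shifted factorial `(a; q)_n = (1 - a)(1 - a q) ⋯ (1 - a q^(n-1))`. -/
def qPoch (a q : ℂ) (n : ℕ) : ℂ :=
  ∏ i ∈ Finset.range n, (1 - a * q ^ i)

/-- The infinite `q`-shifted factorial `(a; q)_∞ = ∏_{n ≥ 0} (1 - a q^n)`, for `|q| < 1`. -/
def qPochInf (a q : ℂ) : ℂ :=
  ∏' n : ℕ, (1 - a * q ^ n)

/-- The infinite product defining `(a; q)_∞` converges whenever `|q| < 1`. -/
theorem hasProd_qPochInf (a : ℂ) {q : ℂ} (hq : ‖q‖ < 1) :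
    HasProd (fun n : ℕ => 1 - a * q ^ n) (qPochInf a q) := by
  have h : Summable (fun n : ℕ => ‖-(a * q ^ n)‖) := by
    simp only [norm_neg, norm_mul, norm_pow]
    exact (summable_geometric_of_lt_one (norm_nonneg q) hq).mul_left _
  have h2 := multipliable_one_add_of_summable h
  simp only [← sub_eq_add_neg] at h2
  exact h2.hasProd

/-- Tuples of natural numbers `N_1 ≥ N_2 ≥ ⋯ ≥ N_r ≥ 0`. -/
def DecTuple (r : ℕ) : Type :=
  {N : Fin r → ℕ // Antitone N}

/-- The entry `N_j`, with `j` counted from `1`; by convention `N_j = 0` for `j > r`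
(and for `j = 0`, which is never used). -/
def DecTuple.entry {r : ℕ} (N : DecTuple r) (j : ℕ) : ℕ :=
  if h : 1 ≤ j ∧ j ≤ r then N.1 ⟨j - 1, by omega⟩ else 0

/-- The exponent `N_1 (N_1 + 1) / 2 + N_2^2 + ⋯ + N_r^2 + N_2 + ⋯ + N_r`
(the division is exact). -/
def DecTuple.exponent {r : ℕ} (N : DecTuple r) : ℕ :=
  N.entry 1 * (N.entry 1 + 1) / 2 + ∑ j ∈ Finset.Icc 2 r, N.entry j ^ 2
    + ∑ j ∈ Finset.Icc 2 r, N.entry j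

/-- The denominator `(q; q)_{N_1 - N_2} ⋯ (q; q)_{N_{r-1} - N_r} (q; q)_{N_r}`. -/
def DecTuple.denom {r : ℕ} (q : ℂ) (N : DecTuple r) : ℂ :=
  ∏ j ∈ Finset.Icc 1 r, qPoch q q (N.entry j - N.entry (j + 1))

end

open Filter Topology

/-! The proof is Bailey's method relative to `a = q`. Start from the unit Bailey pair, whose `β` is
`δ_{n,0}`, and apply the Bailey lemma with both parameters sent to infinity `k - 1` times. Each
application multiplies `α_r` by `q^(r^2+r)` and replaces `β_n` by `∑_j q^(j^2+j) β_j / (q)_{n-j}`;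
this is the `q`-Chu–Vandermonde sum (`sum_baileyAlpha`). Unfolding the recursion, `β_n` is the part
of the multisum with `N_1 = n` fixed (`DecTuple.hasSum_weight_fiber`).

The outer sum over `N_1`, with weight `q^(n(n+1)/2) (-q)_n`, is a Bailey lemma with one parameter
`-q` and the other infinite (`hasSum_baileyBeta_mul`). It rests on the limiting `q`-Gauss sum and
turns the multisum into `(-q)_∞ / (q)_∞ · ∑ (-1)^r q^(k r^2 + (k-1) r) (1 - q^(2r+1))`. The Jacobi
triple product in base `q^(2k)` evaluates this theta series (`hasSum_baileyAlpha_mul`). -/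

/-! ### Shifted factorials: recurrences, non-vanishing, uniform bounds. -/

theorem qPoch_zero (a q : ℂ) : qPoch a q 0 = 1 := by simp [qPoch]

theorem qPoch_succ (a q : ℂ) (n : ℕ) : qPoch a q (n + 1) = qPoch a q n * (1 - a * q ^ n) := by
  simp [qPoch, Finset.prod_range_succ]

theorem qPoch_add (a q : ℂ) (m n : ℕ) :
    qPoch a q (m + n) = qPoch a q m * qPoch (a * q ^ m) q n := by
  simp [qPoch, Finset.prod_range_add, pow_add, mul_assoc]

theorem qPoch_succ' (a q : ℂ) (n : ℕ) : qPoch a q (n + 1) = (1 - a) * qPoch (a * q) q n := by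
  rw [add_comm, qPoch_add]
  simp [qPoch]

theorem qPoch_self_succ (q : ℂ) (n : ℕ) :
    qPoch q q (n + 1) = qPoch q q n * (1 - q ^ (n + 1)) := by
  rw [qPoch_succ, pow_succ']

theorem tendsto_qPoch (a : ℂ) {q : ℂ} (hq : ‖q‖ < 1) :
    Tendsto (qPoch a q) atTop (𝓝 (qPochInf a q)) :=
  (hasProd_qPochInf a hq).tendsto_prod_nat

theorem qPochInf_eq_qPoch_mul (a : ℂ) {q : ℂ} (hq : ‖q‖ < 1) (n : ℕ) :
    qPochInf a q = qPoch a q n * qPochInf (a * q ^ n) q := by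
  have h1 : Tendsto (fun m => qPoch a q (n + m)) atTop (𝓝 (qPochInf a q)) := by
    simp only [add_comm n]
    exact (tendsto_add_atTop_iff_nat n).2 (tendsto_qPoch a hq)
  simp only [qPoch_add] at h1
  exact tendsto_nhds_unique h1 ((tendsto_qPoch _ hq).const_mul _)

theorem one_sub_mul_pow_ne_zero {a q : ℂ} (ha : ‖a‖ < 1) (hq : ‖q‖ < 1) (n : ℕ) :
    1 - a * q ^ n ≠ 0 := by
  intro h
  have h1 : ‖a * q ^ n‖ = 1 := by rw [← sub_eq_zero.1 h, norm_one]
  rw [norm_mul, norm_pow] at h1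
  have h2 : ‖q‖ ^ n ≤ 1 := pow_le_one₀ (norm_nonneg _) hq.le
  nlinarith [norm_nonneg a, norm_nonneg q]

theorem one_sub_pow_ne_zero {q : ℂ} (hq : ‖q‖ < 1) {n : ℕ} (hn : n ≠ 0) : 1 - q ^ n ≠ 0 := by
  obtain ⟨m, rfl⟩ := Nat.exists_eq_succ_of_ne_zero hn
  rw [Nat.succ_eq_add_one, pow_succ']
  exact one_sub_mul_pow_ne_zero hq hq m

theorem qPoch_ne_zero {a q : ℂ} (ha : ‖a‖ < 1) (hq : ‖q‖ < 1) (n : ℕ) : qPoch a q n ≠ 0 :=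
  Finset.prod_ne_zero_iff.2 fun i _ => one_sub_mul_pow_ne_zero ha hq i

theorem qPochInf_ne_zero {a q : ℂ} (ha : ‖a‖ < 1) (hq : ‖q‖ < 1) : qPochInf a q ≠ 0 := by
  have h : Summable (fun n : ℕ => ‖-(a * q ^ n)‖) := by
    simp only [norm_neg, norm_mul, norm_pow]
    exact (summable_geometric_of_lt_one (norm_nonneg q) hq).mul_left _
  have h2 := tprod_one_add_ne_zero_of_summable (f := fun n : ℕ => -(a * q ^ n))
    (fun n => by rw [← sub_eq_add_neg]; exact one_sub_mul_pow_ne_zero ha hq n) h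
  simpa only [← sub_eq_add_neg, qPochInf] using h2

/-- Factor by factor `|1 - a q^i| ≤ 1 + |q|^i`, so the convergent, hence bounded, sequence `(-1;
|q|)_n` dominates. Uniformity in `a` and `n` serves the dominated convergence arguments. -/
theorem exists_norm_qPoch_le {q : ℂ} (hq : ‖q‖ < 1) :
    ∃ C : ℝ, 0 < C ∧ ∀ (a : ℂ) (n : ℕ), ‖a‖ ≤ 1 → ‖qPoch a q n‖ ≤ C := by
  have hq' : ‖(‖q‖ : ℂ)‖ < 1 := by simpa using hq
  obtain ⟨C, hC⟩ := (Metric.isBounded_range_of_tendsto _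
    (tendsto_qPoch (-1) hq')).exists_norm_le
  refine ⟨max C 1, by positivity, fun a n ha => le_trans ?_
    ((hC _ ⟨n, rfl⟩).trans (le_max_left _ _))⟩
  rw [qPoch, qPoch, norm_prod, norm_prod]
  refine Finset.prod_le_prod (fun _ _ => norm_nonneg _) fun i _ => ?_
  have h1 : ‖(1 : ℂ) - -1 * (‖q‖ : ℂ) ^ i‖ = 1 + ‖q‖ ^ i := by
    have : (1 : ℂ) - -1 * (‖q‖ : ℂ) ^ i = ((1 + ‖q‖ ^ i : ℝ) : ℂ) := by push_cast; ring
    rw [this, Complex.norm_real, Real.norm_of_nonneg (by positivity)]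
  rw [h1]
  refine (norm_sub_le _ _).trans ?_
  rw [norm_one, norm_mul, norm_pow]
  have := mul_le_mul_of_nonneg_right ha (pow_nonneg (norm_nonneg q) i)
  linarith

/-- Here `|1 - a q^i| ≥ 1 - |q|^(i+1)`, and `(|q|; |q|)_n` has a nonzero limit, so its inverses are
bounded. -/
theorem exists_norm_inv_qPoch_le {q : ℂ} (hq : ‖q‖ < 1) :
    ∃ C : ℝ, 0 < C ∧ ∀ (a : ℂ) (n : ℕ), ‖a‖ ≤ ‖q‖ → ‖(qPoch a q n)⁻¹‖ ≤ C := by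
  have hq' : ‖(‖q‖ : ℂ)‖ < 1 := by simpa using hq
  obtain ⟨C, hC⟩ := (Metric.isBounded_range_of_tendsto _
    ((tendsto_qPoch (‖q‖ : ℂ) hq').inv₀ (qPochInf_ne_zero hq' hq'))).exists_norm_le
  refine ⟨max C 1, by positivity, fun a n ha => le_trans ?_
    ((hC _ ⟨n, rfl⟩).trans (le_max_left _ _))⟩
  rw [norm_inv, norm_inv]
  refine inv_anti₀ (norm_pos_iff.2 (qPoch_ne_zero hq' hq' n)) ?_
  rw [qPoch, qPoch, norm_prod, norm_prod]
  refine Finset.prod_le_prod (fun _ _ => norm_nonneg _) fun i _ => ?_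
  have h2 : ‖q‖ ^ i ≤ 1 := pow_le_one₀ (norm_nonneg _) hq.le
  have h1 : ‖(1 : ℂ) - (‖q‖ : ℂ) * (‖q‖ : ℂ) ^ i‖ = 1 - ‖q‖ * ‖q‖ ^ i := by
    have : (1 : ℂ) - (‖q‖ : ℂ) * (‖q‖ : ℂ) ^ i = ((1 - ‖q‖ * ‖q‖ ^ i : ℝ) : ℂ) := by
      push_cast; ring
    rw [this, Complex.norm_real, Real.norm_of_nonneg]
    nlinarith [norm_nonneg q]
  rw [h1]
  refine le_trans ?_ (norm_sub_norm_le _ _)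
  rw [norm_one, norm_mul, norm_pow]
  have := mul_le_mul_of_nonneg_right ha (pow_nonneg (norm_nonneg q) i)
  linarith

/-! ### The Bailey chain from the unit Bailey pair. -/

/-- A finite form of the `q`-Chu–Vandermonde sum. -/
theorem sum_qChuVandermonde {q : ℂ} (hq : ‖q‖ < 1) (M a : ℕ) :
    ∑ i ∈ Finset.range (M + 1),
      q ^ (i * (i + a)) / (qPoch q q (M - i) * qPoch q q i * qPoch q q (i + a)) =
      1 / (qPoch q q M * qPoch q q (M + a)) := by
  have hne := fun n => qPoch_ne_zero hq hq n
  induction M generalizing a with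
  | zero => simp [qPoch_zero]
  | succ M ih =>
    have hM : (1 : ℂ) - q ^ (M + 1) ≠ 0 := one_sub_pow_ne_zero hq (Nat.succ_ne_zero M)
    have hMa : (1 : ℂ) - q ^ (M + a + 1) ≠ 0 := one_sub_pow_ne_zero hq (Nat.succ_ne_zero _)
    -- Split `1 - q^(M+1) = (1 - q^(M+1-i)) + q^(M+1-i) (1 - q^i)`. The first part lowers
    -- `(q)_{M+1-i}`; the second lowers `(q)_i` and, after shifting `i`, is the sum for `a + 1`,
    -- which is why the induction generalizes `a`.
    have key : (1 - q ^ (M + 1)) * ∑ i ∈ Finset.range (M + 1 + 1),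
        q ^ (i * (i + a)) / (qPoch q q (M + 1 - i) * qPoch q q i * qPoch q q (i + a)) =
        ∑ i ∈ Finset.range (M + 1),
          q ^ (i * (i + a)) / (qPoch q q (M - i) * qPoch q q i * qPoch q q (i + a)) +
        q ^ (M + 1 + a) * ∑ i ∈ Finset.range (M + 1),
          q ^ (i * (i + (a + 1))) /
            (qPoch q q (M - i) * qPoch q q i * qPoch q q (i + (a + 1))) := by
      have h1 : ∀ i ∈ Finset.range (M + 1 + 1), (1 - q ^ (M + 1)) *
          (q ^ (i * (i + a)) / (qPoch q q (M + 1 - i) * qPoch q q i * qPoch q q (i + a))) =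
          (1 - q ^ (M + 1 - i)) * (q ^ (i * (i + a)) /
            (qPoch q q (M + 1 - i) * qPoch q q i * qPoch q q (i + a))) +
          q ^ (M + 1 - i) * (1 - q ^ i) * (q ^ (i * (i + a)) /
            (qPoch q q (M + 1 - i) * qPoch q q i * qPoch q q (i + a))) := by
        intro i hi
        have : q ^ (M + 1) = q ^ (M + 1 - i) * q ^ i := by
          rw [← pow_add]; congr 1; have := Finset.mem_range.1 hi; omega
        rw [this]; ring
      rw [Finset.mul_sum, Finset.sum_congr rfl h1, Finset.sum_add_distrib]
      congr 1
      · rw [Finset.sum_range_succ]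
        simp only [Nat.sub_self, pow_zero, sub_self, zero_mul, add_zero]
        refine Finset.sum_congr rfl fun i hi => ?_
        have hi' : M + 1 - i = (M - i) + 1 := by have := Finset.mem_range.1 hi; omega
        have h3 : (1 : ℂ) - q ^ (M - i + 1) ≠ 0 := one_sub_pow_ne_zero hq (Nat.succ_ne_zero _)
        have := hne (M - i); have := hne i; have := hne (i + a)
        rw [hi', qPoch_self_succ q (M - i)]
        field_simp
      · rw [Finset.sum_range_succ', Finset.mul_sum]
        simp only [pow_zero, sub_self, mul_zero, zero_mul, add_zero]
        refine Finset.sum_congr rfl fun i hi => ?_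
        have hi' : M + 1 - (i + 1) = M - i := by omega
        have h3 : (1 : ℂ) - q ^ (i + 1) ≠ 0 := one_sub_pow_ne_zero hq (Nat.succ_ne_zero _)
        have := hne (M - i); have := hne i; have := hne (i + (a + 1))
        have h4 : q ^ (M - i) * q ^ ((i + 1) * (i + 1 + a)) =
            q ^ (M + 1 + a) * q ^ (i * (i + (a + 1))) := by
          rw [← pow_add, ← pow_add]; congr 1
          obtain ⟨d, rfl⟩ := Nat.exists_eq_add_of_le (Nat.lt_succ_iff.1 (Finset.mem_range.1 hi))
          rw [Nat.add_sub_cancel_left]; ring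
        have h5 : i + 1 + a = i + (a + 1) := by ring
        rw [hi', qPoch_self_succ q i]
        rw [h5] at h4 ⊢
        field_simp
        linear_combination h4
    rw [ih, ih] at key
    have h6 : M + 1 + a = M + a + 1 := by ring
    have h7 : M + (a + 1) = M + a + 1 := by ring
    rw [h6, h7] at key
    refine mul_left_cancel₀ hM (key.trans ?_)
    have := hne M; have := hne (M + a)
    rw [h6, qPoch_self_succ q M, qPoch_self_succ q (M + a)]
    field_simp
    ring

/-- The `α`-sequence of the `m`-th Bailey pair relative to `q` in the chain starting at the unit
Bailey pair, up to the factor `1 - q`. -/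
noncomputable def baileyAlpha (q : ℂ) (m r : ℕ) : ℂ :=
  (-1) ^ r * q ^ (m * (r ^ 2 + r) + r.choose 2) * (1 - q ^ (2 * r + 1))

/-- The `β`-sequence of the `m`-th Bailey pair relative to `q` in the chain starting at the unit
Bailey pair. -/
noncomputable def baileyBeta (q : ℂ) : ℕ → ℕ → ℂ
  | 0, n => if n = 0 then 1 else 0
  | m + 1, n => ∑ j ∈ Finset.range (n + 1),
      q ^ (j ^ 2 + j) / qPoch q q (n - j) * baileyBeta q m j

theorem choose_two_succ (r : ℕ) : (r + 1).choose 2 = r.choose 2 + r := by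
  rw [Nat.choose_succ_succ' r 1, Nat.choose_one_right, add_comm]

theorem choose_two_add (m n : ℕ) :
    (m + n).choose 2 = m.choose 2 + n.choose 2 + m * n := by
  induction n with
  | zero => simp
  | succ n ih => rw [← add_assoc, choose_two_succ, choose_two_succ, ih]; ring

theorem mul_succ_div_two (n : ℕ) : n * (n + 1) / 2 = n.choose 2 + n := by
  rw [← choose_two_succ, Nat.choose_two_right, Nat.add_sub_cancel, mul_comm]

theorem sq_eq_choose_two (n : ℕ) : n ^ 2 = 2 * n.choose 2 + n := by
  induction n with
  | zero => simp
  | succ n ih => rw [choose_two_succ]; linear_combination ih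

/-- The sum telescopes once multiplied by `1 - q^n`. At `R = n` the closed form is the negative of
the remaining term `r = n`, so the full sum vanishes for `n ≠ 0`. -/
theorem sum_baileyAlpha_zero_range {q : ℂ} (hq : ‖q‖ < 1) {n R : ℕ} (hR : R ≤ n) :
    (1 - q ^ n) * ∑ r ∈ Finset.range R,
      baileyAlpha q 0 r / (qPoch q q (n - r) * qPoch q q (n + r + 1)) =
      -((-1) ^ R * q ^ R.choose 2 * (1 - q ^ R) / (qPoch q q (n - R) * qPoch q q (n + R))) := by
  have hne := fun n => qPoch_ne_zero hq hq n
  induction R with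
  | zero => simp
  | succ R ih =>
    rw [Finset.sum_range_succ, mul_add, ih (by omega)]
    obtain ⟨d, rfl⟩ := Nat.exists_eq_add_of_le hR
    have e1 : R + 1 + d - R = d + 1 := by omega
    have e2 : R + 1 + d - (R + 1) = d := by omega
    have e3 : R + 1 + d + (R + 1) = R + 1 + d + R + 1 := by omega
    have h1 : (1 : ℂ) - q ^ (d + 1) ≠ 0 := one_sub_pow_ne_zero hq (Nat.succ_ne_zero _)
    have h2 : (1 : ℂ) - q ^ (R + 1 + d + R + 1) ≠ 0 := one_sub_pow_ne_zero hq (Nat.succ_ne_zero _)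
    rw [e1, e2, e3, qPoch_self_succ q d, qPoch_self_succ q (R + 1 + d + R), choose_two_succ,
      baileyAlpha]
    have := hne d; have := hne (R + 1 + d + R)
    field_simp
    ring

theorem sum_baileyAlpha_zero {q : ℂ} (hq : ‖q‖ < 1) (n : ℕ) :
    ∑ r ∈ Finset.range (n + 1),
      baileyAlpha q 0 r / (qPoch q q (n - r) * qPoch q q (n + r + 1)) = baileyBeta q 0 n := by
  have hne := fun n => qPoch_ne_zero hq hq n
  rcases eq_or_ne n 0 with rfl | hn
  · have := hne 1
    have h1 : qPoch q q 1 = 1 - q := by simp [qPoch]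
    rw [h1] at this
    simp [baileyAlpha, baileyBeta, qPoch_zero, h1, this]
  · have hn' := one_sub_pow_ne_zero hq hn
    refine mul_left_cancel₀ hn' ?_
    rw [Finset.sum_range_succ, mul_add, sum_baileyAlpha_zero_range hq le_rfl, baileyBeta,
      if_neg hn, baileyAlpha, qPoch_self_succ, Nat.sub_self, qPoch_zero]
    have := hne (n + n)
    have h2 : (1 : ℂ) - q ^ (n + n + 1) ≠ 0 := one_sub_pow_ne_zero hq (Nat.succ_ne_zero _)
    field_simp
    ring

theorem baileyAlpha_succ (q : ℂ) (m r : ℕ) :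
    baileyAlpha q (m + 1) r = q ^ (r ^ 2 + r) * baileyAlpha q m r := by
  simp only [baileyAlpha]; ring

/-- `baileyAlpha` and `baileyBeta` form a Bailey pair. -/
theorem sum_baileyAlpha {q : ℂ} (hq : ‖q‖ < 1) (m n : ℕ) :
    ∑ r ∈ Finset.range (n + 1),
      baileyAlpha q m r / (qPoch q q (n - r) * qPoch q q (n + r + 1)) = baileyBeta q m n := by
  have hne := fun n => qPoch_ne_zero hq hq n
  induction m generalizing n with
  | zero => exact sum_baileyAlpha_zero hq n
  | succ m ih =>
    rw [baileyBeta]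
    simp_rw [← ih, Finset.mul_sum]
    rw [Finset.sum_comm' (t' := Finset.range (n + 1)) (s' := fun r => Finset.Ico r (n + 1))
      (by intro x y; simp only [Finset.mem_range, Finset.mem_Ico]; omega)]
    refine Finset.sum_congr rfl fun r hr => ?_
    obtain ⟨d, rfl⟩ := Nat.exists_eq_add_of_le (Nat.lt_succ_iff.1 (Finset.mem_range.1 hr))
    have e1 : r + d + 1 - r = d + 1 := by omega
    have e2 : r + d - r = d := by omega
    have e3 : r + d + r + 1 = d + (2 * r + 1) := by omega
    rw [Finset.sum_Ico_eq_sum_range, e1, e2, e3, baileyAlpha_succ]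
    -- With `j = r + i`, `j^2 + j = (r^2 + r) + i (i + 2r + 1)`, so the inner sum is Chu–Vandermonde
    -- with `a = 2r + 1`.
    have hcv := sum_qChuVandermonde hq d (2 * r + 1)
    calc _ = q ^ (r ^ 2 + r) * baileyAlpha q m r * (1 / (qPoch q q d * qPoch q q (d + (2 * r + 1)))) := by
          ring
      _ = _ := by
          rw [← hcv, Finset.mul_sum]
          refine Finset.sum_congr rfl fun i _ => ?_
          have e4 : r + d - (r + i) = d - i := by omega
          have e5 : r + i - r = i := by omega
          have e6 : r + i + r + 1 = i + (2 * r + 1) := by omega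
          have e7 : q ^ ((r + i) ^ 2 + (r + i)) = q ^ (r ^ 2 + r) * q ^ (i * (i + (2 * r + 1))) := by
            rw [← pow_add]; congr 1; ring
          rw [e4, e5, e6, e7]
          have := hne (d - i); have := hne i; have := hne (i + (2 * r + 1))
          field_simp

/-! ### The limiting `q`-Gauss sum and the conjugate Bailey pair. -/

/-- The summand of the `₁φ₁` series `∑ (x)_i (-y)^i q^(i(i-1)/2) / ((q)_i (xy)_i)`. -/
noncomputable def phiTerm (q x y : ℂ) (i : ℕ) : ℂ :=
  qPoch x q i * (-y) ^ i * q ^ i.choose 2 / (qPoch q q i * qPoch (x * y) q i)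

theorem exists_norm_phiTerm_le {q : ℂ} (hq : ‖q‖ < 1) :
    ∃ C : ℝ, ∀ (x y : ℂ) (i : ℕ), ‖x‖ ≤ 1 → ‖y‖ ≤ ‖q‖ → ‖phiTerm q x y i‖ ≤ C * ‖q‖ ^ i := by
  obtain ⟨C, hC0, hC⟩ := exists_norm_qPoch_le hq
  obtain ⟨D, hD0, hD⟩ := exists_norm_inv_qPoch_le hq
  refine ⟨C * D * D, fun x y i hx hy => ?_⟩
  have hxy : ‖x * y‖ ≤ ‖q‖ := by
    rw [norm_mul]
    nlinarith [norm_nonneg x, norm_nonneg y]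
  have e : phiTerm q x y i = qPoch x q i * (qPoch q q i)⁻¹ * (qPoch (x * y) q i)⁻¹ * (-y) ^ i *
      q ^ i.choose 2 := by
    rw [phiTerm, div_eq_mul_inv, mul_inv]; ring
  rw [e]
  simp only [norm_mul, norm_pow, norm_neg]
  have h1 := hC x i hx
  have h2 := hD q i le_rfl
  have h3 := hD _ i hxy
  have h4 : ‖y‖ ^ i ≤ ‖q‖ ^ i := pow_le_pow_left₀ (norm_nonneg _) hy i
  have h5 : ‖q‖ ^ i.choose 2 ≤ 1 := pow_le_one₀ (norm_nonneg _) hq.le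
  calc _ ≤ C * D * D * ‖q‖ ^ i * 1 := by gcongr
    _ = _ := mul_one _

/-- A telescoping certificate: the right side is `g (i + 1) - g i`, where `g 0 = 0` because of the
factor `1 - q^i`. Summed over `i`, it relates the series at `y` and at `y q`. -/
theorem phiTerm_contiguous {q x y : ℂ} (hq : ‖q‖ < 1) (hxy : ‖x * y‖ < 1) (i : ℕ) :
    (1 - x * y) * phiTerm q x y i - (1 - y) * phiTerm q x (y * q) i =
      -(qPoch x q (i + 1) * (-y) ^ (i + 1) * q ^ (i + 1).choose 2 /
          (qPoch q q (i + 1) * qPoch (x * y * q) q (i + 1)) * (1 - q ^ (i + 1)) *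
          (1 - x * y * q * q ^ i)) -
      -(qPoch x q i * (-y) ^ i * q ^ i.choose 2 /
          (qPoch q q i * qPoch (x * y * q) q i) * (1 - q ^ i) * (1 - x * y * q ^ i)) := by
  have hxyq : ‖x * y * q‖ < 1 := by
    rw [norm_mul]; nlinarith [norm_nonneg (x * y), norm_nonneg q]
  have h0 : 1 - x * y ≠ 0 := by simpa using one_sub_mul_pow_ne_zero hxy hq 0
  have h1 := qPoch_ne_zero hq hq i
  have h2 := qPoch_ne_zero hxyq hq i
  have h3 := qPoch_ne_zero hxy hq i
  have h4 : 1 - x * y * q * q ^ i ≠ 0 := one_sub_mul_pow_ne_zero hxyq hq i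
  have h5 : (1 : ℂ) - q ^ (i + 1) ≠ 0 := one_sub_pow_ne_zero hq (Nat.succ_ne_zero _)
  have h6 : 1 - x * y * q ^ i ≠ 0 := one_sub_mul_pow_ne_zero hxy hq i
  -- Brings the terms at `y` and `y q` over the common factor `(xyq)_i`.
  have h7 : (1 - x * y) / qPoch (x * y) q i = (1 - x * y * q ^ i) / qPoch (x * y * q) q i := by
    rw [div_eq_div_iff h3 h2, ← qPoch_succ', qPoch_succ, mul_comm]
  have e1 : (1 - x * y) * phiTerm q x y i =
      qPoch x q i * (-y) ^ i * q ^ i.choose 2 * (1 - x * y * q ^ i) /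
        (qPoch q q i * qPoch (x * y * q) q i) := by
    calc _ = qPoch x q i * (-y) ^ i * q ^ i.choose 2 / qPoch q q i *
          ((1 - x * y) / qPoch (x * y) q i) := by
          rw [phiTerm]; field_simp
      _ = _ := by rw [h7]; field_simp
  rw [e1, phiTerm, ← mul_assoc x y q, qPoch_self_succ q i, qPoch_succ (x * y * q), qPoch_succ x,
    choose_two_succ]
  have e2 : (-(y * q)) ^ i = (-y) ^ i * q ^ i := by rw [← mul_pow]; ring
  rw [e2]
  generalize 1 - x * y * q * q ^ i = D at h4 ⊢
  generalize 1 - q ^ (i + 1) = E at h5 ⊢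
  field_simp
  ring

theorem summable_phiTerm {q x y : ℂ} (hq : ‖q‖ < 1) (hx : ‖x‖ ≤ 1) (hy : ‖y‖ ≤ ‖q‖) :
    Summable (phiTerm q x y) := by
  obtain ⟨C, hC⟩ := exists_norm_phiTerm_le hq
  exact Summable.of_norm_bounded
    ((summable_geometric_of_lt_one (norm_nonneg q) hq).mul_left C) fun i => hC x y i hx hy

theorem tsum_phiTerm_contiguous {q x y : ℂ} (hq : ‖q‖ < 1) (hx : ‖x‖ ≤ 1) (hy : ‖y‖ ≤ ‖q‖) :
    (1 - x * y) * ∑' i, phiTerm q x y i = (1 - y) * ∑' i, phiTerm q x (y * q) i := by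
  have hxy' : ‖x * y‖ ≤ ‖q‖ := by
    rw [norm_mul]
    nlinarith [norm_nonneg x, norm_nonneg y]
  have hyq : ‖y * q‖ ≤ ‖q‖ := by
    rw [norm_mul]; nlinarith [norm_nonneg y, norm_nonneg q]
  have hxyq : ‖x * y * q‖ ≤ ‖q‖ := by
    rw [norm_mul]; nlinarith [norm_nonneg (x * y), norm_nonneg q]
  have hs := ((summable_phiTerm hq hx hy).hasSum.mul_left (1 - x * y)).sub
    ((summable_phiTerm hq hx hyq).hasSum.mul_left (1 - y))
  set g : ℕ → ℂ := fun i => -(qPoch x q i * (-y) ^ i * q ^ i.choose 2 /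
    (qPoch q q i * qPoch (x * y * q) q i) * (1 - q ^ i) * (1 - x * y * q ^ i)) with hg
  have hg' : ∀ i, (1 - x * y) * phiTerm q x y i - (1 - y) * phiTerm q x (y * q) i =
      g (i + 1) - g i := by
    intro i
    rw [phiTerm_contiguous hq (hxy'.trans_lt hq), hg]
    simp only [pow_succ', mul_assoc]
  simp only [hg'] at hs
  have ht := hs.tendsto_sum_nat
  simp only [Finset.sum_range_sub] at ht
  have hlim : Tendsto g atTop (𝓝 0) := by
    obtain ⟨C, hC0, hC⟩ := exists_norm_qPoch_le hq
    obtain ⟨D, hD0, hD⟩ := exists_norm_inv_qPoch_le hq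
    refine squeeze_zero_norm (a := fun i => C * D * D * 2 * 2 * ‖q‖ ^ i) (fun i => ?_) ?_
    · have e : g i = -(qPoch x q i * (qPoch q q i)⁻¹ * (qPoch (x * y * q) q i)⁻¹ *
          (1 - q ^ i) * (1 - x * y * q ^ i) * (-y) ^ i * q ^ i.choose 2) := by
        simp only [hg]; rw [div_eq_mul_inv, mul_inv]; ring
      rw [e]
      simp only [norm_mul, norm_pow, norm_neg]
      have h1 := hC x i hx
      have h2 := hD q i le_rfl
      have h3 := hD _ i hxyq
      have h4 : ‖y‖ ^ i ≤ ‖q‖ ^ i := pow_le_pow_left₀ (norm_nonneg _) hy i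
      have h5 : ‖q‖ ^ i.choose 2 ≤ 1 := pow_le_one₀ (norm_nonneg _) hq.le
      have hp : ‖q‖ ^ i ≤ 1 := pow_le_one₀ (norm_nonneg _) hq.le
      have h6 : ‖1 - q ^ i‖ ≤ 2 := by
        refine (norm_sub_le _ _).trans ?_
        rw [norm_one, norm_pow]; linarith
      have h7 : ‖1 - x * y * q ^ i‖ ≤ 2 := by
        refine (norm_sub_le _ _).trans ?_
        rw [norm_one, norm_mul, norm_pow]
        nlinarith [norm_nonneg (x * y), pow_nonneg (norm_nonneg q) i]
      calc _ ≤ C * D * D * 2 * 2 * ‖q‖ ^ i * 1 := by gcongr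
        _ = _ := mul_one _
    · simpa using (tendsto_pow_atTop_nhds_zero_of_lt_one (norm_nonneg q) hq).const_mul
        (C * D * D * 2 * 2)
  have hg0 : g 0 = 0 := by simp [hg]
  rw [hg0] at ht
  simp only [sub_zero] at ht
  exact sub_eq_zero.1 (tendsto_nhds_unique ht hlim)

theorem norm_mul_pow_le {y q : ℂ} (hq : ‖q‖ < 1) (n : ℕ) : ‖y * q ^ n‖ ≤ ‖y‖ := by
  rw [norm_mul, norm_pow]
  exact mul_le_of_le_one_right (norm_nonneg _) (pow_le_one₀ (norm_nonneg _) hq.le)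

/-- Iterating the contiguous relation drives `y` to `y q^n`, hence to `0` in the limit, where only
the term `i = 0` survives. -/
theorem qPoch_mul_tsum_phiTerm {q x y : ℂ} (hq : ‖q‖ < 1) (hx : ‖x‖ ≤ 1) (hy : ‖y‖ ≤ ‖q‖)
    (n : ℕ) :
    qPoch (x * y) q n * ∑' i, phiTerm q x y i =
      qPoch y q n * ∑' i, phiTerm q x (y * q ^ n) i := by
  induction n with
  | zero => simp [qPoch_zero]
  | succ n ih =>
    have h := tsum_phiTerm_contiguous hq hx ((norm_mul_pow_le hq n).trans hy)
    rw [mul_assoc y, ← pow_succ] at h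
    rw [qPoch_succ, qPoch_succ, mul_right_comm, ih]
    linear_combination qPoch y q n * h

/-- The limiting `q`-Gauss sum. -/
theorem hasSum_phiTerm {q x y : ℂ} (hq : ‖q‖ < 1) (hx : ‖x‖ ≤ 1) (hy : ‖y‖ ≤ ‖q‖) :
    HasSum (phiTerm q x y) (qPochInf y q / qPochInf (x * y) q) := by
  have hxy : ‖x * y‖ < 1 := by
    rw [norm_mul]
    nlinarith [norm_nonneg x, norm_nonneg y]
  have h1 := (tendsto_qPoch (x * y) hq).mul_const (∑' i, phiTerm q x y i)
  have hpow : Tendsto (fun n : ℕ => y * q ^ n) atTop (𝓝 0) := by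
    simpa using (tendsto_pow_atTop_nhds_zero_of_norm_lt_one hq).const_mul y
  have h2 : Tendsto (fun n : ℕ => ∑' i, phiTerm q x (y * q ^ n) i) atTop
      (𝓝 (∑' i, phiTerm q x 0 i)) := by
    obtain ⟨C, hC⟩ := exists_norm_phiTerm_le hq
    refine tendsto_tsum_of_dominated_convergence
      ((summable_geometric_of_lt_one (norm_nonneg q) hq).mul_left C) (fun i => ?_)
      (Eventually.of_forall fun n i => hC x _ i hx ((norm_mul_pow_le hq n).trans hy))
    have hc : ContinuousAt (fun z => phiTerm q x z i) 0 := by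
      unfold phiTerm
      refine ContinuousAt.div (by fun_prop) (by unfold qPoch; fun_prop) ?_
      exact mul_ne_zero (qPoch_ne_zero hq hq i) (qPoch_ne_zero (by simp) hq i)
    exact hc.tendsto.comp hpow
  have h3 : ∑' i, phiTerm q x 0 i = 1 := by
    rw [tsum_eq_single 0]
    · simp [phiTerm, qPoch_zero]
    · intro i hi
      simp [phiTerm, hi]
  rw [h3] at h2
  have h4 := (tendsto_qPoch y hq).mul h2
  simp only [← qPoch_mul_tsum_phiTerm hq hx hy, mul_one] at h4
  have h5 := tendsto_nhds_unique h1 h4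
  rw [← h5, mul_div_cancel_left₀ _ (qPochInf_ne_zero hxy hq)]
  exact (summable_phiTerm hq hx hy).hasSum

/-- The conjugate Bailey pair used for the outermost sum. -/
theorem hasSum_conjugateBailey {q : ℂ} (hq : ‖q‖ < 1) (r : ℕ) :
    HasSum (fun i => q ^ ((r + i) * (r + i + 1) / 2) * qPoch (-q) q (r + i) /
        (qPoch q q i * qPoch q q (r + i + r + 1)))
      (q ^ (r * (r + 1) / 2) * (qPochInf (-q) q / qPochInf q q)) := by
  have hx : ‖-(q * q ^ r)‖ ≤ ‖q‖ := by rw [norm_neg]; exact norm_mul_pow_le hq r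
  -- Take `x = y = -q^(r+1)`, so that `xy = q^(2r+2)`; the prefactor restores the initial parts of
  -- `(-q)_{r+i}` and `(q)_{2r+1+i}`.
  have h := (hasSum_phiTerm hq (hx.trans hq.le) hx).mul_left
    (q ^ (r * (r + 1) / 2) * qPoch (-q) q r / qPoch q q (2 * r + 1))
  have hxx : -(q * q ^ r) * -(q * q ^ r) = q * q ^ (2 * r + 1) := by ring
  have hneg : -(q * q ^ r) = -q * q ^ r := by ring
  have h1 := qPoch_ne_zero hq hq (2 * r + 1)
  have h2 : qPochInf (q * q ^ (2 * r + 1)) q ≠ 0 :=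
    qPochInf_ne_zero ((norm_mul_pow_le hq _).trans_lt hq) hq
  have hv : q ^ (r * (r + 1) / 2) * qPoch (-q) q r / qPoch q q (2 * r + 1) *
      (qPochInf (-(q * q ^ r)) q / qPochInf (q * q ^ (2 * r + 1)) q) =
      q ^ (r * (r + 1) / 2) * (qPochInf (-q) q / qPochInf q q) := by
    rw [qPochInf_eq_qPoch_mul (-q) hq r, qPochInf_eq_qPoch_mul q hq (2 * r + 1), hneg]
    field_simp
  rw [hxx, hv] at h
  refine h.congr_fun fun i => ?_
  have h3 := qPoch_ne_zero hq hq i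
  have h4 : qPoch (q * q ^ (2 * r + 1)) q i ≠ 0 :=
    qPoch_ne_zero ((norm_mul_pow_le hq _).trans_lt hq) hq i
  have e1 : r + i + r + 1 = 2 * r + 1 + i := by ring
  have e2 : q ^ ((r + i) * (r + i + 1) / 2) =
      q ^ (r * (r + 1) / 2) * (- -(q * q ^ r)) ^ i * q ^ i.choose 2 := by
    have e3 : (r + i) * (r + i + 1) / 2 = r * (r + 1) / 2 + (1 + r) * i + i.choose 2 := by
      rw [mul_succ_div_two, mul_succ_div_two, choose_two_add]
      ring
    rw [e3, neg_neg, ← pow_succ', ← pow_mul, ← pow_add, ← pow_add, add_comm 1 r]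
  rw [phiTerm, hxx, e1, qPoch_add q q (2 * r + 1), qPoch_add (-q) q r, e2, hneg]
  field_simp

/-! ### The `q`-binomial theorem and the Jacobi triple product. -/

/-- The `q`-binomial theorem, in homogeneous form. -/
theorem prod_sub_mul_pow_eq_sum {q : ℂ} (hq : ‖q‖ < 1) (x z : ℂ) (N : ℕ) :
    ∏ i ∈ Finset.range N, (x - z * q ^ i) = qPoch q q N *
      ∑ j ∈ Finset.range (N + 1),
        (-z) ^ j * x ^ (N - j) * q ^ j.choose 2 / (qPoch q q j * qPoch q q (N - j)) := by
  have hne := fun n => qPoch_ne_zero hq hq n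
  induction N with
  | zero => simp [qPoch_zero]
  | succ N ih =>
    -- The same splitting of `1 - q^(N+1)` as in `sum_qChuVandermonde`; the two parts contribute `x`
    -- and `-z q^N`.
    have key : (1 - q ^ (N + 1)) * ∑ j ∈ Finset.range (N + 1 + 1),
        (-z) ^ j * x ^ (N + 1 - j) * q ^ j.choose 2 / (qPoch q q j * qPoch q q (N + 1 - j)) =
        (x - z * q ^ N) * ∑ j ∈ Finset.range (N + 1),
          (-z) ^ j * x ^ (N - j) * q ^ j.choose 2 / (qPoch q q j * qPoch q q (N - j)) := by
      have h1 : ∀ j ∈ Finset.range (N + 1 + 1), (1 - q ^ (N + 1)) *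
          ((-z) ^ j * x ^ (N + 1 - j) * q ^ j.choose 2 /
            (qPoch q q j * qPoch q q (N + 1 - j))) =
          (1 - q ^ (N + 1 - j)) * ((-z) ^ j * x ^ (N + 1 - j) * q ^ j.choose 2 /
            (qPoch q q j * qPoch q q (N + 1 - j))) +
          q ^ (N + 1 - j) * (1 - q ^ j) * ((-z) ^ j * x ^ (N + 1 - j) * q ^ j.choose 2 /
            (qPoch q q j * qPoch q q (N + 1 - j))) := by
        intro j hj
        have : q ^ (N + 1) = q ^ (N + 1 - j) * q ^ j := by
          rw [← pow_add]; congr 1; have := Finset.mem_range.1 hj; omega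
        rw [this]; ring
      rw [Finset.mul_sum, Finset.sum_congr rfl h1, Finset.sum_add_distrib, sub_mul,
        sub_eq_add_neg]
      congr 1
      · rw [Finset.sum_range_succ, Finset.mul_sum]
        simp only [Nat.sub_self, pow_zero, sub_self, zero_mul, add_zero]
        refine Finset.sum_congr rfl fun j hj => ?_
        have hj' : N + 1 - j = (N - j) + 1 := by have := Finset.mem_range.1 hj; omega
        have h3 : (1 : ℂ) - q ^ (N - j + 1) ≠ 0 := one_sub_pow_ne_zero hq (Nat.succ_ne_zero _)
        have := hne (N - j); have := hne j
        rw [hj', qPoch_self_succ q (N - j)]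
        field_simp
        ring
      · rw [Finset.sum_range_succ', ← neg_mul, Finset.mul_sum]
        simp only [pow_zero, sub_self, mul_zero, zero_mul, add_zero]
        refine Finset.sum_congr rfl fun j hj => ?_
        have hj' : N + 1 - (j + 1) = N - j := by omega
        have h3 : (1 : ℂ) - q ^ (j + 1) ≠ 0 := one_sub_pow_ne_zero hq (Nat.succ_ne_zero _)
        have := hne (N - j); have := hne j
        have h4 : q ^ N = q ^ (N - j) * q ^ j := by
          rw [← pow_add]; congr 1; have := Finset.mem_range.1 hj; omega
        rw [hj', qPoch_self_succ q j, choose_two_succ, h4]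
        field_simp
        ring
    rw [Finset.prod_range_succ, ih, qPoch_self_succ]
    linear_combination -qPoch q q N * key

theorem prod_pow_range (q : ℂ) (n : ℕ) : ∏ i ∈ Finset.range n, q ^ i = q ^ n.choose 2 := by
  rw [Finset.prod_pow_eq_pow_sum, Finset.sum_range_id, Nat.choose_two_right]

/-- The paired terms of the bilateral series in the Jacobi triple product identity. -/
noncomputable def thetaTerm (q a b : ℂ) (r : ℕ) : ℂ :=
  (-1) ^ r * (q ^ r.choose 2 * a ^ r - q ^ (r + 1).choose 2 * b ^ (r + 1))

/-- A finite form of the Jacobi triple product identity. -/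
theorem sum_thetaTerm {q a b : ℂ} (hq : ‖q‖ < 1) (hq0 : q ≠ 0) (hab : a * b = q) (n : ℕ) :
    ∑ r ∈ Finset.range (n + 1), thetaTerm q a b r / (qPoch q q (n - r) * qPoch q q (n + r + 1)) =
      qPoch a q n * qPoch b q (n + 1) / qPoch q q (2 * n + 1) := by
  have hb0 : b ≠ 0 := by rintro rfl; simp at hab; exact hq0 hab.symm
  have hne := fun n => qPoch_ne_zero hq hq n
  -- With `x = q^n` the factors `i < n` give `(a)_n`, since `q^n = a b q^(n-1)`, and the factors `i
  -- ≥ n` give `(b)_{n+1}`.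
  have hbin := prod_sub_mul_pow_eq_sum hq (q ^ n) b (2 * n + 1)
  have hL : ∏ i ∈ Finset.range (2 * n + 1), (q ^ n - b * q ^ i) =
      (-b) ^ n * q ^ (n * (n + 1) + n.choose 2) * (qPoch a q n * qPoch b q (n + 1)) := by
    rw [show 2 * n + 1 = n + (n + 1) by ring, Finset.prod_range_add]
    have h1 : ∀ i ∈ Finset.range n, q ^ n - b * q ^ i =
        -b * q ^ i * (1 - a * q ^ (n - 1 - i)) := by
      intro i hi
      obtain ⟨d, rfl⟩ := Nat.exists_eq_add_of_lt (Finset.mem_range.1 hi)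
      rw [show i + d + 1 - 1 - i = d by omega, ← hab]
      ring
    have h2 : ∀ i ∈ Finset.range (n + 1), q ^ n - b * q ^ (n + i) = q ^ n * (1 - b * q ^ i) := by
      intro i _
      ring
    rw [Finset.prod_congr rfl h1, Finset.prod_congr rfl h2, Finset.prod_mul_distrib,
      Finset.prod_mul_distrib, Finset.prod_mul_distrib, prod_pow_range, Finset.prod_const,
      Finset.prod_const, Finset.card_range, Finset.card_range,
      Finset.prod_range_reflect (fun i => 1 - a * q ^ i) n, qPoch, qPoch]
    ring
  -- The terms `j = n - r` and `j = n + 1 + r` share a denominator and combine into `thetaTerm q a b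
  -- r`.
  have hR : ∑ j ∈ Finset.range (2 * n + 1 + 1), (-b) ^ j * (q ^ n) ^ (2 * n + 1 - j) *
      q ^ j.choose 2 / (qPoch q q j * qPoch q q (2 * n + 1 - j)) =
      (-b) ^ n * q ^ (n * (n + 1) + n.choose 2) * ∑ r ∈ Finset.range (n + 1),
        thetaTerm q a b r / (qPoch q q (n - r) * qPoch q q (n + r + 1)) := by
    rw [show 2 * n + 1 + 1 = (n + 1) + (n + 1) by ring, Finset.sum_range_add,
      ← Finset.sum_range_reflect, ← Finset.sum_add_distrib, Finset.mul_sum]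
    refine Finset.sum_congr rfl fun r hr => ?_
    obtain ⟨d, rfl⟩ := Nat.exists_eq_add_of_le (Nat.lt_succ_iff.1 (Finset.mem_range.1 hr))
    rw [show r + d + 1 - 1 - r = d by omega, show 2 * (r + d) + 1 - d = r + d + r + 1 by omega,
      show 2 * (r + d) + 1 - (r + d + 1 + r) = d by omega, show r + d - r = d by omega,
      show r + d + 1 + r = r + d + r + 1 by omega, thetaTerm]
    have e1 : (-b) ^ d * (q ^ (r + d)) ^ (r + d + r + 1) * q ^ d.choose 2 =
        (-b) ^ (r + d) * q ^ ((r + d) * (r + d + 1) + (r + d).choose 2) *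
          ((-1) ^ r * (q ^ r.choose 2 * a ^ r)) := by
      have h3 : (-b) ^ (r + d) * ((-1) ^ r * a ^ r) = (-b) ^ d * q ^ r := by
        rw [← hab, pow_add, neg_pow b r, mul_pow]
        have : ((-1 : ℂ) ^ r) * (-1) ^ r = 1 := by rw [← mul_pow]; simp
        linear_combination (-b) ^ d * b ^ r * a ^ r * this
      have h4 := sq_eq_choose_two r
      have h5 : (r + d) * (r + d + r + 1) + d.choose 2 =
          r + ((r + d) * (r + d + 1) + (r + d).choose 2) + r.choose 2 := by
        rw [choose_two_add]; linear_combination h4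
      calc _ = (-b) ^ d * q ^ ((r + d) * (r + d + r + 1) + d.choose 2) := by
            rw [← pow_mul, pow_add]; ring
        _ = ((-b) ^ d * q ^ r) * q ^ ((r + d) * (r + d + 1) + (r + d).choose 2) *
              q ^ r.choose 2 := by rw [h5]; ring
        _ = _ := by rw [← h3]; ring
    have e2 : (-b) ^ (r + d + r + 1) * (q ^ (r + d)) ^ d * q ^ (r + d + r + 1).choose 2 =
        -((-b) ^ (r + d) * q ^ ((r + d) * (r + d + 1) + (r + d).choose 2) *
          ((-1) ^ r * (q ^ (r + 1).choose 2 * b ^ (r + 1)))) := by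
      have h5 : (r + d) * d + (r + d + r + 1).choose 2 =
          (r + d) * (r + d + 1) + (r + d).choose 2 + (r + 1).choose 2 := by
        rw [add_assoc (r + d) r 1, choose_two_add (r + d) (r + 1)]; ring
      calc _ = (-b) ^ (r + d + r + 1) * q ^ ((r + d) * d + (r + d + r + 1).choose 2) := by
            rw [← pow_mul, pow_add q]; ring
        _ = _ := by
            rw [h5, add_assoc (r + d) r 1, pow_add (-b) (r + d), neg_pow b (r + 1)]; ring
    rw [e1, e2]
    ring
  rw [hL, hR] at hbin
  have h0 : (-b) ^ n * q ^ (n * (n + 1) + n.choose 2) ≠ 0 :=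
    mul_ne_zero (pow_ne_zero _ (neg_ne_zero.2 hb0)) (pow_ne_zero _ hq0)
  rw [eq_div_iff (hne _)]
  refine mul_left_cancel₀ h0 ?_
  rw [hbin]
  ring

theorem norm_thetaTerm_le {q a b : ℂ} (hq : ‖q‖ < 1) (hb : ‖b‖ < 1) (r : ℕ) :
    ‖thetaTerm q a b r‖ ≤ ‖a‖ ^ r + ‖b‖ ^ r := by
  rw [thetaTerm, norm_mul, norm_pow, norm_neg, norm_one, one_pow, one_mul]
  refine (norm_sub_le _ _).trans ?_
  simp only [norm_mul, norm_pow]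
  refine add_le_add
    (mul_le_of_le_one_left (by positivity) (pow_le_one₀ (norm_nonneg _) hq.le)) ?_
  refine (mul_le_of_le_one_left (by positivity) (pow_le_one₀ (norm_nonneg _) hq.le)).trans ?_
  exact pow_le_pow_of_le_one (norm_nonneg _) hb.le (Nat.le_succ r)

/-- The Jacobi triple product identity. -/
theorem hasSum_thetaTerm {q a b : ℂ} (hq0 : q ≠ 0) (ha : ‖a‖ < 1) (hb : ‖b‖ < 1)
    (hab : a * b = q) :
    HasSum (thetaTerm q a b) (qPochInf b q * qPochInf a q * qPochInf q q) := by
  have hq : ‖q‖ < 1 := by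
    rw [← hab, norm_mul]; nlinarith [norm_nonneg a, norm_nonneg b]
  have hQ := qPochInf_ne_zero hq hq
  have hgeom := (summable_geometric_of_lt_one (norm_nonneg a) ha).add
    (summable_geometric_of_lt_one (norm_nonneg b) hb)
  have hs : Summable (thetaTerm q a b) :=
    Summable.of_norm_bounded hgeom (norm_thetaTerm_le hq hb)
  -- Extending the finite identity by zero allows dominated convergence as `n → ∞`.
  set f : ℕ → ℕ → ℂ := fun n r => if r ≤ n then
    thetaTerm q a b r / (qPoch q q (n - r) * qPoch q q (n + r + 1)) else 0 with hf
  have hqn := tendsto_qPoch q hq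
  have hlim : Tendsto (fun n => ∑' r, f n r) atTop
      (𝓝 (∑' r, thetaTerm q a b r / (qPochInf q q * qPochInf q q))) := by
    obtain ⟨D, hD0, hD⟩ := exists_norm_inv_qPoch_le hq
    refine tendsto_tsum_of_dominated_convergence (hgeom.mul_right (D * D)) (fun r => ?_)
      (Eventually.of_forall fun n r => ?_)
    · have h1 : Tendsto (fun n => thetaTerm q a b r /
          (qPoch q q (n - r) * qPoch q q (n + r + 1))) atTop
          (𝓝 (thetaTerm q a b r / (qPochInf q q * qPochInf q q))) := by
        refine tendsto_const_nhds.div (Tendsto.mul ?_ ?_) (mul_ne_zero hQ hQ)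
        · exact hqn.comp (tendsto_sub_atTop_nat r)
        · exact hqn.comp (tendsto_add_atTop_nat (r + 1))
      refine h1.congr' ?_
      filter_upwards [eventually_ge_atTop r] with n hn
      rw [hf]
      exact (if_pos hn).symm
    · rw [hf]
      dsimp only
      split_ifs
      · rw [div_eq_mul_inv, mul_inv, norm_mul, norm_mul]
        have h1 := norm_thetaTerm_le (a := a) hq hb r
        have h2 := hD q (n - r) le_rfl
        have h3 := hD q (n + r + 1) le_rfl
        gcongr
      · rw [norm_zero]; positivity
  have hsum : ∀ n, ∑' r, f n r = qPoch a q n * qPoch b q (n + 1) / qPoch q q (2 * n + 1) := by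
    intro n
    rw [← sum_thetaTerm hq hq0 hab, tsum_eq_sum (s := Finset.range (n + 1))]
    · refine Finset.sum_congr rfl fun r hr => ?_
      rw [hf]
      exact if_pos (Nat.lt_succ_iff.1 (Finset.mem_range.1 hr))
    · intro r hr
      rw [hf]
      exact if_neg fun h => hr (Finset.mem_range.2 (Nat.lt_succ_iff.2 h))
  simp only [hsum] at hlim
  have hlim' : Tendsto (fun n => qPoch a q n * qPoch b q (n + 1) / qPoch q q (2 * n + 1)) atTop
      (𝓝 (qPochInf a q * qPochInf b q / qPochInf q q)) := by
    refine Tendsto.div ((tendsto_qPoch a hq).mul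
      ((tendsto_qPoch b hq).comp (tendsto_add_atTop_nat 1))) (hqn.comp ?_) hQ
    exact tendsto_atTop_mono (fun n => (by omega : n ≤ 2 * n + 1)) tendsto_id
  have h := tendsto_nhds_unique hlim hlim'
  rw [tsum_div_const] at h
  have h' : ∑' r, thetaTerm q a b r = qPochInf b q * qPochInf a q * qPochInf q q := by
    field_simp at h
    rw [h]; ring
  rw [← h']
  exact hs.hasSum

theorem hasSum_baileyAlpha_mul {q : ℂ} (hq : ‖q‖ < 1) (m : ℕ) :
    HasSum (fun r => baileyAlpha q (m + 1) r * q ^ (r * (r + 1) / 2))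
      (qPochInf q (q ^ (2 * (m + 2))) * qPochInf (q ^ (2 * (m + 2) - 1)) (q ^ (2 * (m + 2))) *
        qPochInf (q ^ (2 * (m + 2))) (q ^ (2 * (m + 2)))) := by
  -- The finite triple product cancels powers of `q` and `b`, so `q = 0` is separate; there only `r
  -- = 0` contributes.
  rcases eq_or_ne q 0 with rfl | hq0
  · have h1 : ∀ n, n ≠ 0 → qPochInf 0 ((0 : ℂ) ^ n) = 1 := fun n _ => by simp [qPochInf]
    have h2 : 2 * (m + 2) - 1 ≠ 0 := by omega
    rw [zero_pow h2, zero_pow (by omega : 2 * (m + 2) ≠ 0)]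
    have h3 : qPochInf 0 0 = 1 := by simp [qPochInf]
    rw [h3]
    convert hasSum_single (f := fun r => baileyAlpha 0 (m + 1) r * (0 : ℂ) ^ (r * (r + 1) / 2)) 0
      (fun r hr => ?_) using 1
    · simp [baileyAlpha]
    · simp [mul_succ_div_two, hr]
  · have h := hasSum_thetaTerm (q := q ^ (2 * (m + 2))) (a := q ^ (2 * (m + 2) - 1)) (b := q)
      (pow_ne_zero _ hq0)
      (by rw [norm_pow]; exact pow_lt_one₀ (norm_nonneg _) hq (by omega)) hq
      (by rw [← pow_succ]; congr 1)
    refine h.congr_fun fun r => ?_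
    rw [thetaTerm, baileyAlpha, mul_succ_div_two, choose_two_succ]
    have h4 := sq_eq_choose_two r
    have e1 : (q ^ (2 * (m + 2))) ^ r.choose 2 * (q ^ (2 * (m + 2) - 1)) ^ r =
        q ^ ((m + 1) * (r ^ 2 + r) + r.choose 2) * q ^ (r.choose 2 + r) := by
      rw [← pow_mul, ← pow_mul, ← pow_add, ← pow_add]
      congr 1
      rw [h4, show 2 * (m + 2) - 1 = 2 * m + 3 by omega]
      ring
    have e2 : (q ^ (2 * (m + 2))) ^ (r.choose 2 + r) * q ^ (r + 1) =
        q ^ ((m + 1) * (r ^ 2 + r) + r.choose 2) * q ^ (r.choose 2 + r) * q ^ (2 * r + 1) := by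
      rw [← pow_mul, ← pow_add, ← pow_add, ← pow_add]
      congr 1
      rw [h4]
      ring
    rw [e1, e2]
    ring

/-! ### Decreasing tuples and the recursion for the multisum. -/

namespace DecTuple

theorem entry_eq {r : ℕ} (N : DecTuple r) {j : ℕ} (h1 : 1 ≤ j) (h2 : j ≤ r) :
    N.entry j = N.1 ⟨j - 1, by omega⟩ := dif_pos ⟨h1, h2⟩

theorem apply_le_entry_one {r : ℕ} (N : DecTuple r) (j : Fin r) : N.1 j ≤ N.entry 1 := by
  have := j.2
  rw [entry_eq N le_rfl (by omega)]
  exact N.2 (Fin.mk_le_of_le_val (Nat.zero_le _))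

/-- Prepend the entry `M_1 + i` to the tuple `M_1 ≥ ⋯ ≥ M_r`. -/
def cons {r : ℕ} (M : DecTuple r) (i : ℕ) : DecTuple (r + 1) :=
  ⟨Fin.cons (M.entry 1 + i) M.1, by
    intro a b
    refine Fin.cases (fun _ => ?_) (fun b hab => ?_) b
    · rename_i hb
      rw [Fin.le_zero_iff.1 hb]
    · revert hab
      refine Fin.cases (fun _ => ?_) (fun a hab => ?_) a
      · rw [Fin.cons_zero, Fin.cons_succ]
        exact (M.apply_le_entry_one b).trans (Nat.le_add_right _ _)
      · rw [Fin.cons_succ, Fin.cons_succ]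
        exact M.2 (Fin.succ_le_succ_iff.1 hab)⟩

theorem entry_cons_one {r : ℕ} (M : DecTuple r) (i : ℕ) :
    (M.cons i).entry 1 = M.entry 1 + i := by
  rw [entry_eq _ le_rfl (by omega)]
  rfl

theorem entry_cons_succ {r : ℕ} (M : DecTuple r) (i : ℕ) {j : ℕ} (hj : 1 ≤ j) :
    (M.cons i).entry (j + 1) = M.entry j := by
  obtain ⟨j, rfl⟩ := Nat.exists_eq_add_of_le' hj
  by_cases h : j + 1 ≤ r
  · rw [entry_eq _ (by omega) (by omega), entry_eq _ hj h]
    rfl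
  · rw [entry, entry, dif_neg (by omega), dif_neg (by omega)]

/-- The inverse removes `N_1` and records `i = N_1 - N_2`. -/
theorem cons_bijective (r : ℕ) :
    Function.Bijective fun p : DecTuple r × ℕ => p.1.cons p.2 := by
  constructor
  · rintro ⟨M, i⟩ ⟨M', i'⟩ h
    have h1 : M.entry 1 + i = M'.entry 1 + i' := by
      rw [← entry_cons_one, ← entry_cons_one]
      exact congrArg (fun N => entry N 1) h
    have h0 : (Fin.cons (M.entry 1 + i) M.1 : Fin (r + 1) → ℕ) =
        Fin.cons (M'.entry 1 + i') M'.1 := congrArg Subtype.val h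
    have h2 : M = M' := Subtype.ext (Fin.cons_inj.1 h0).2
    subst h2
    simpa using h1
  · intro N
    let M : DecTuple r := ⟨Fin.tail N.1, fun a b hab => N.2 (Fin.succ_le_succ_iff.2 hab)⟩
    have hM : M.entry 1 ≤ N.1 0 := by
      by_cases h : 1 ≤ r
      · rw [entry_eq _ le_rfl h]
        exact N.2 (Fin.zero_le _)
      · rw [entry, dif_neg (by omega)]
        exact Nat.zero_le _
    refine ⟨(M, N.1 0 - M.entry 1), Subtype.ext ?_⟩
    change Fin.cons (M.entry 1 + (N.1 0 - M.entry 1)) (Fin.tail N.1) = N.1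
    rw [Nat.add_sub_cancel' hM, Fin.cons_self_tail]

/-- The factor of the multisum depending on more than `N_1` alone. -/
noncomputable def weight (q : ℂ) {r : ℕ} (N : DecTuple r) : ℂ :=
  q ^ (∑ j ∈ Finset.Icc 2 r, (N.entry j ^ 2 + N.entry j)) / N.denom q

theorem _root_.Finset.prod_Icc_one_succ {M : Type*} [CommMonoid M] (f : ℕ → M) (r : ℕ) :
    ∏ j ∈ Finset.Icc 1 (r + 1), f j = f 1 * ∏ j ∈ Finset.Icc 1 r, f (j + 1) := by
  rw [← Finset.insert_Icc_succ_left_eq_Icc (by omega), Finset.prod_insert (by simp),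
    Nat.succ_eq_succ, Nat.succ_eq_add_one, ← Finset.map_add_right_Icc 1 r 1, Finset.prod_map]
  rfl

theorem weight_cons (q : ℂ) {r : ℕ} (M : DecTuple r) (i : ℕ) :
    (M.cons i).weight q = q ^ (M.entry 1 ^ 2 + M.entry 1) / qPoch q q i * M.weight q := by
  have h1 : (M.cons i).denom q = qPoch q q i * M.denom q := by
    rw [denom, Finset.prod_Icc_one_succ, entry_cons_one, entry_cons_succ _ _ le_rfl,
      Nat.add_sub_cancel_left, denom]
    congr 1
    refine Finset.prod_congr rfl fun j hj => ?_
    have hj1 := (Finset.mem_Icc.1 hj).1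
    rw [entry_cons_succ _ _ hj1, entry_cons_succ _ _ (by omega)]
  have h2 : ∑ j ∈ Finset.Icc 2 (r + 1), ((M.cons i).entry j ^ 2 + (M.cons i).entry j) =
      (M.entry 1 ^ 2 + M.entry 1) + ∑ j ∈ Finset.Icc 2 r, (M.entry j ^ 2 + M.entry j) := by
    rw [← Finset.map_add_right_Icc 1 r 1, Finset.sum_map]
    rw [Finset.sum_congr rfl (g := fun j => M.entry j ^ 2 + M.entry j)]
    -- For `r = 0` the default `M.entry 1 = 0` makes the extra exponent vanish.
    · rcases Nat.eq_zero_or_pos r with rfl | hr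
      · simp [entry]
      · rw [← Finset.insert_Icc_succ_left_eq_Icc hr, Finset.sum_insert (by simp)]
        rfl
    · intro j hj
      have hj1 := (Finset.mem_Icc.1 hj).1
      rw [addRightEmbedding_apply, entry_cons_succ _ _ hj1]
  rw [weight, h1, h2, pow_add, weight, mul_div_mul_comm]

/-- Tuples with `r + 1` entries and `N_1 = n` arise from tuples with `r` entries and `M_1 ≤ n`. -/
noncomputable def fiberEquiv (r n : ℕ) :
    (Σ j : Fin (n + 1), {M : DecTuple r // M.entry 1 = j}) ≃
      {N : DecTuple (r + 1) // N.entry 1 = n} :=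
  Equiv.ofBijective
    (fun p => ⟨p.2.1.cons (n - p.1), by
      have := p.1.2
      rw [entry_cons_one, p.2.2]; omega⟩) <| by
    constructor
    · rintro ⟨⟨j, hj⟩, M, hM⟩ ⟨⟨j', hj'⟩, M', hM'⟩ h
      have h1 := (cons_bijective r).1 (a₁ := (M, n - j)) (a₂ := (M', n - j'))
        (congrArg Subtype.val h)
      obtain rfl : M = M' := congrArg Prod.fst h1
      obtain rfl : j = j' := hM.symm.trans hM'
      rfl
    · rintro ⟨N, hN⟩
      obtain ⟨⟨M, i⟩, rfl⟩ := (cons_bijective r).2 N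
      rw [entry_cons_one] at hN
      change M.entry 1 + i = n at hN
      refine ⟨⟨⟨M.entry 1, by omega⟩, M, rfl⟩, Subtype.ext ?_⟩
      change M.cons (n - M.entry 1) = M.cons i
      congr 1
      omega

instance : Unique (DecTuple 0) where
  default := ⟨Fin.elim0, fun a => a.elim0⟩
  uniq _ := Subtype.ext (funext fun a => a.elim0)

theorem finite_fiber (r n : ℕ) : Finite {N : DecTuple r // N.entry 1 = n} := by
  induction r generalizing n with
  | zero => infer_instance
  | succ r ih => exact Finite.of_equiv _ (fiberEquiv r n)

/-- The index `j` in the recursion for `baileyBeta` is the next entry `N_2`. The empty tuple has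
first entry `0` by convention, which matches `δ_{n,0}`. -/
theorem hasSum_weight_fiber (q : ℂ) (r n : ℕ) :
    HasSum (fun N : {N : DecTuple r // N.entry 1 = n} => N.1.weight q) (baileyBeta q r n) := by
  induction r generalizing n with
  | zero =>
    rw [baileyBeta]
    split_ifs with h
    · subst h
      let _ : Unique {N : DecTuple 0 // N.entry 1 = 0} :=
        ⟨⟨⟨default, rfl⟩⟩, fun N => Subtype.ext (Subsingleton.elim _ _)⟩
      simp [weight, denom]
    · have : IsEmpty {N : DecTuple 0 // N.entry 1 = n} := ⟨fun N => h (by rw [← N.2]; rfl)⟩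
      exact hasSum_empty
  | succ r ih =>
    rw [← (fiberEquiv r n).hasSum_iff]
    have := fun j : ℕ => finite_fiber r j
    have h := hasSum_fintype fun j : Fin (n + 1) =>
      q ^ ((j : ℕ) ^ 2 + j) / qPoch q q (n - j) * baileyBeta q r j
    rw [Fin.sum_univ_eq_sum_range
      (fun j => q ^ (j ^ 2 + j) / qPoch q q (n - j) * baileyBeta q r j)] at h
    refine HasSum.sigma_of_hasSum h (fun j => ?_) Summable.of_finite
    refine ((ih j).mul_left (q ^ ((j : ℕ) ^ 2 + j) / qPoch q q (n - j))).congr_fun fun M => ?_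
    change (M.1.cons (n - j)).weight q = _
    rw [weight_cons, M.2]

/-- The factor `‖q‖ ^ N_1` is needed: for one entry the weight `1 / (q)_{N_1}` does not decay. As
`N_1 = M_1 + i`, it splits into a geometric series in `i` and the factor required by induction. -/
theorem summable_norm_weight {q : ℂ} (hq : ‖q‖ < 1) (r : ℕ) :
    Summable fun N : DecTuple r => ‖q‖ ^ N.entry 1 * ‖N.weight q‖ := by
  induction r with
  | zero => exact Summable.of_finite
  | succ r ih =>
    obtain ⟨D, hD0, hD⟩ := exists_norm_inv_qPoch_le hq
    rw [← (Equiv.ofBijective _ (cons_bijective r)).summable_iff]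
    have hs := ih.mul_of_nonneg ((summable_geometric_of_lt_one (norm_nonneg q) hq).mul_left D)
      (fun _ => mul_nonneg (pow_nonneg (norm_nonneg q) _) (norm_nonneg _))
      (fun _ => mul_nonneg hD0.le (pow_nonneg (norm_nonneg q) _))
    refine hs.of_nonneg_of_le
      (fun _ => mul_nonneg (pow_nonneg (norm_nonneg q) _) (norm_nonneg _)) fun p => ?_
    obtain ⟨M, i⟩ := p
    change ‖q‖ ^ (M.cons i).entry 1 * ‖(M.cons i).weight q‖ ≤
      ‖q‖ ^ M.entry 1 * ‖M.weight q‖ * (D * ‖q‖ ^ i)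
    rw [weight_cons, entry_cons_one, norm_mul, div_eq_mul_inv, norm_mul, norm_pow]
    have h1 := hD q i le_rfl
    have h2 : ‖q‖ ^ (M.entry 1 ^ 2 + M.entry 1) ≤ 1 := pow_le_one₀ (norm_nonneg _) hq.le
    calc _ ≤ ‖q‖ ^ (M.entry 1 + i) * (1 * D * ‖M.weight q‖) := by gcongr
      _ = _ := by rw [pow_add]; ring

theorem summand_eq (q : ℂ) {r : ℕ} (N : DecTuple r) :
    q ^ N.exponent * qPoch (-q) q (N.entry 1) / N.denom q =
      q ^ (N.entry 1 * (N.entry 1 + 1) / 2) * qPoch (-q) q (N.entry 1) * N.weight q := by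
  rw [exponent, add_assoc, ← Finset.sum_add_distrib, pow_add, weight]
  ring

theorem summable_summand {q : ℂ} (hq : ‖q‖ < 1) (r : ℕ) :
    Summable fun N : DecTuple r =>
      q ^ N.exponent * qPoch (-q) q (N.entry 1) / N.denom q := by
  obtain ⟨C, hC0, hC⟩ := exists_norm_qPoch_le hq
  refine Summable.of_norm_bounded ((summable_norm_weight hq r).mul_left C) fun N => ?_
  rw [summand_eq, norm_mul, norm_mul, norm_pow]
  have h1 := hC (-q) (N.entry 1) (by rw [norm_neg]; exact hq.le)
  have h2 : ‖q‖ ^ (N.entry 1 * (N.entry 1 + 1) / 2) ≤ ‖q‖ ^ N.entry 1 :=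
    pow_le_pow_of_le_one (norm_nonneg _) hq.le (by rw [mul_succ_div_two]; omega)
  calc _ ≤ ‖q‖ ^ N.entry 1 * C * ‖N.weight q‖ := by gcongr
    _ = _ := by ring

end DecTuple

/-! ### The limiting Bailey lemma and the conclusion. -/

theorem norm_baileyAlpha_le {q : ℂ} (hq : ‖q‖ < 1) (m r : ℕ) : ‖baileyAlpha q m r‖ ≤ 2 := by
  rw [baileyAlpha, norm_mul, norm_mul, norm_pow, norm_neg, norm_one, one_pow, one_mul, norm_pow]
  have h1 : ‖q‖ ^ (m * (r ^ 2 + r) + r.choose 2) ≤ 1 := pow_le_one₀ (norm_nonneg _) hq.le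
  have h2 : ‖1 - q ^ (2 * r + 1)‖ ≤ 2 := by
    refine (norm_sub_le _ _).trans ?_
    rw [norm_one, norm_pow]
    have : ‖q‖ ^ (2 * r + 1) ≤ 1 := pow_le_one₀ (norm_nonneg _) hq.le
    linarith
  calc _ ≤ (1 : ℝ) * 2 := by gcongr
    _ = 2 := one_mul 2

/-- Domination by a multiple of `‖q‖ ^ (r + i)` licenses summing the double series by rows or by
antidiagonals. -/
theorem summable_baileyAlpha_mul_conjugate {q : ℂ} (hq : ‖q‖ < 1) (m : ℕ) :
    Summable fun p : ℕ × ℕ => baileyAlpha q m p.1 *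
      (q ^ ((p.1 + p.2) * (p.1 + p.2 + 1) / 2) * qPoch (-q) q (p.1 + p.2) /
        (qPoch q q p.2 * qPoch q q (p.1 + p.2 + p.1 + 1))) := by
  obtain ⟨C, hC0, hC⟩ := exists_norm_qPoch_le hq
  obtain ⟨D, hD0, hD⟩ := exists_norm_inv_qPoch_le hq
  have hg := summable_geometric_of_lt_one (norm_nonneg q) hq
  refine Summable.of_norm_bounded ((hg.mul_of_nonneg hg (fun _ => pow_nonneg (norm_nonneg q) _)
    (fun _ => pow_nonneg (norm_nonneg q) _)).mul_left (2 * C * D * D)) fun p => ?_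
  rw [div_eq_mul_inv, mul_inv]
  simp only [norm_mul, norm_pow]
  have h1 := hC (-q) (p.1 + p.2) (by rw [norm_neg]; exact hq.le)
  have h2 : ‖q‖ ^ ((p.1 + p.2) * (p.1 + p.2 + 1) / 2) ≤ ‖q‖ ^ (p.1 + p.2) :=
    pow_le_pow_of_le_one (norm_nonneg _) hq.le (by rw [mul_succ_div_two]; omega)
  have h3 := hD q p.2 le_rfl
  have h4 := hD q (p.1 + p.2 + p.1 + 1) le_rfl
  have h5 := norm_baileyAlpha_le hq m p.1
  calc _ ≤ 2 * (‖q‖ ^ (p.1 + p.2) * C * (D * D)) := by gcongr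
    _ = _ := by rw [pow_add]; ring

/-- The limiting case of Bailey's lemma relative to `q` with one parameter equal to `-q`. -/
theorem hasSum_baileyBeta_mul {q θ : ℂ} (hq : ‖q‖ < 1) (m : ℕ)
    (hθ : HasSum (fun r => baileyAlpha q m r * q ^ (r * (r + 1) / 2)) θ) :
    HasSum (fun n => q ^ (n * (n + 1) / 2) * qPoch (-q) q n * baileyBeta q m n)
      (θ * (qPochInf (-q) q / qPochInf q q)) := by
  obtain ⟨S, hu⟩ := summable_baileyAlpha_mul_conjugate hq m
  have hrow : HasSum (fun r => baileyAlpha q m r *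
      (q ^ (r * (r + 1) / 2) * (qPochInf (-q) q / qPochInf q q))) S :=
    hu.prod_fiberwise fun r => (hasSum_conjugateBailey hq r).mul_left (baileyAlpha q m r)
  have hθ' : HasSum (fun r => baileyAlpha q m r *
      (q ^ (r * (r + 1) / 2) * (qPochInf (-q) q / qPochInf q q)))
      (θ * (qPochInf (-q) q / qPochInf q q)) :=
    (hθ.mul_right _).congr_fun fun r => (mul_assoc _ _ _).symm
  rw [hθ'.unique hrow]
  -- Rows were summed by the conjugate Bailey pair; the antidiagonal `r + i = n` gives the Bailey
  -- pair relation for `β_n`.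
  rw [← Finset.HasAntidiagonal.sigmaAntidiagonalEquivProd.hasSum_iff] at hu
  refine (hu.sigma fun n => hasSum_fintype _).congr_fun fun n => ?_
  rw [← sum_baileyAlpha hq, Finset.mul_sum,
    ← Finset.Nat.sum_antidiagonal_eq_sum_range_succ_mk
      (f := fun p : ℕ × ℕ => q ^ (n * (n + 1) / 2) * qPoch (-q) q n *
        (baileyAlpha q m p.1 / (qPoch q q p.2 * qPoch q q (n + p.1 + 1)))),
    ← Finset.sum_coe_sort]
  refine Finset.sum_congr rfl fun p _ => ?_
  have hp := Finset.HasAntidiagonal.mem_antidiagonal.1 p.2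
  simp only [Function.comp_apply, Finset.HasAntidiagonal.sigmaAntidiagonalEquivProd_apply, hp]
  ring

theorem theorem2p1 (k : ℕ) (hk : 2 ≤ k) (q : ℂ) (hq : ‖q‖ < 1) :
    HasSum
      (fun N : DecTuple (k - 1) =>
        q ^ N.exponent * qPoch (-q) q (N.entry 1) / N.denom q)
      (qPochInf (-q) q * qPochInf q (q ^ (2 * k)) * qPochInf (q ^ (2 * k - 1)) (q ^ (2 * k)) *
          qPochInf (q ^ (2 * k)) (q ^ (2 * k)) / qPochInf q q) := by
  obtain ⟨m, rfl⟩ := Nat.exists_eq_add_of_le' hk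
  have hβ := hasSum_baileyBeta_mul hq (m + 1) (hasSum_baileyAlpha_mul hq m)
  have hF := (DecTuple.summable_summand hq (m + 1)).hasSum
  have hF' := hF
  -- Group the tuples by `N_1 = n`; each fibre sums to the `n`-th term of the `β` series.
  rw [← (Equiv.sigmaFiberEquiv fun N : DecTuple (m + 1) => N.entry 1).hasSum_iff] at hF'
  have hfib := hF'.sigma (g := fun n =>
    q ^ (n * (n + 1) / 2) * qPoch (-q) q n * baileyBeta q (m + 1) n) fun n =>
    ((DecTuple.hasSum_weight_fiber q (m + 1) n).mul_left _).congr_fun fun N => by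
      change q ^ N.1.exponent * qPoch (-q) q (N.1.entry 1) / N.1.denom q = _
      rw [DecTuple.summand_eq, N.2]
  rw [hfib.unique hβ] at hF
  have hv : ∀ a b c d e : ℂ, a * b * c * d / e = b * c * d * (a / e) := by intros; ring
  rw [hv]
  exact hF
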